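/- Let $M\ge 0$ and let $d_1,\dots,d_M$ be positive integers; put $\omega_k:=\sum_{j=k+1}^M d_j$ for $0\le k\le M$. A multifold partition diamond of type $(d_1,\dots,d_M)$ consists of nonnegative integers $\ell_0,\dots,\ell_M$ (the links) and $f_{k,i}$ for $1\le k\le M$, $1\le i\le d_k$ (the folds), such that $$\ell_{k-1}\le f_{k,i}\le \ell_k\qquad(1\le k\le M,\ 1\le i\le d_k).$$ Let $$\sigma_{d_1,\dots,d_M}(a,b):=\sum a^{\sum_{k,i} f_{k,i}}\, b^{\ell_0+\cdots+\ell_M}\in\mathbb{Z}[[a,b]],$$ the sum being over all multifold partition diamonds of type $(d_1,\dots,d_M)$. For $d\ge1$ let $E_d(x,y):=\sum_{\tau\in S_d}x^{\mathrm{des}(\tau)}y^{\mathrm{maj}(\tau)}$ be the Euler--Mahonian polynomial, where $\mathrm{Des}(\tau)=\{1\le j<d:\tau(j)>\tau(j+1)\}$, $\mathrm{des}(\tau)=|\mathrm{Des}(\tau)|$ and $\mathrm{maj}(\tau)=\sum_{j\in\mathrm{Des}(\tau)}j$. Theorem. In $\mathbb{Z}[[a,b]]$ the denominator below is invertible and $$\sigma_{d_1,\dots,d_M}(a,b)=\frac{\prod_{k=1}^M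 E_{d_k}\!\left(a^{\omega_k}b^{M-k+1},a\right)}{\left(1-a^{\omega_0}b^{M+1}\right)\prod_{k=1}^M\prod_{j=0}^{d_k}\left(1-a^{\omega_k+d_k-j}\,b^{M-k+1}\right)}.$$ -/

import Mathlib

namespace Multifold

/-- The (zero-based) descent positions of a permutation of `d` letters. The element `i` stands for
the one-based position `i + 1`. -/
def desSet {d : ℕ} (τ : Equiv.Perm (Fin d)) : Finset (Fin d) :=
  Finset.univ.filter fun i => ∃ h : (i : ℕ) + 1 < d, τ ⟨(i : ℕ) + 1, h⟩ < τ i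

/-- The number of descents. -/
def des {d : ℕ} (τ : Equiv.Perm (Fin d)) : ℕ := (desSet τ).card

/-- The major index: the sum of the one-based descent positions. -/
def maj {d : ℕ} (τ : Equiv.Perm (Fin d)) : ℕ := ∑ i ∈ desSet τ, ((i : ℕ) + 1)

/-- The Euler--Mahonian polynomial `E_d`, evaluated at `(x, y)`. -/
def eulerMahonian {R : Type*} [CommSemiring R] (d : ℕ) (x y : R) : R :=
  ∑ τ : Equiv.Perm (Fin d), x ^ des τ * y ^ maj τ

/-- A multifold partition diamond of length `M` whose `k`-th diamond has `d k` folds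
(indices `k` are zero-based): there are `M + 1` links, the `k`-th diamond lies between the links
`k` and `k + 1`, and the parts are nonnegative integers that weakly increase along the poset
`{link 0} ⊕ (folds 0) ⊕ {link 1} ⊕ ⋯ ⊕ (folds (M - 1)) ⊕ {link M}`. -/
@[ext]
structure Diamond {M : ℕ} (d : Fin M → ℕ) where
  link : Fin (M + 1) → ℕ
  fold : (k : Fin M) → Fin (d k) → ℕ
  link_le_fold : ∀ k i, link k.castSucc ≤ fold k i
  fold_le_link : ∀ k i, fold k i ≤ link k.succ

/-- The sum of all parts in the folds. -/
def Diamond.foldSum {M : ℕ} {d : Fin M → ℕ} (p : Diamond d) : ℕ :=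
  ∑ k : Fin M, ∑ i : Fin (d k), p.fold k i

/-- The sum of all parts in the links. -/
def Diamond.linkSum {M : ℕ} {d : Fin M → ℕ} (p : Diamond d) : ℕ :=
  ∑ k : Fin (M + 1), p.link k

/-- The diamonds with prescribed sum of folds and sum of links. -/
def diamondsOf {M : ℕ} (d : Fin M → ℕ) (m n : ℕ) : Set (Diamond d) :=
  {p | p.foldSum = m ∧ p.linkSum = n}

/-- Only finitely many diamonds have given sums, so that counting them is meaningful. -/
theorem diamondsOf_finite {M : ℕ} (d : Fin M → ℕ) (m n : ℕ) : (diamondsOf d m n).Finite := by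
  let f : Diamond d → (Fin (M + 1) → ℕ) × ((k : Fin M) → Fin (d k) → ℕ) :=
    fun p => (p.link, p.fold)
  have hf : Function.Injective f := by
    intro p q h
    simp only [f, Prod.mk.injEq] at h
    exact Diamond.ext h.1 h.2
  have hfin : ((Set.Iic (fun _ => n) : Set (Fin (M + 1) → ℕ)) ×ˢ
      (Set.Iic (fun _ _ => m) : Set ((k : Fin M) → Fin (d k) → ℕ))).Finite :=
    Set.Finite.prod (Set.finite_Iic _) (Set.finite_Iic _)
  refine (hfin.preimage hf.injOn).subset ?_
  rintro p ⟨h1, h2⟩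
  refine ⟨fun k => ?_, fun k i => ?_⟩
  · rw [← h2]
    exact Finset.single_le_sum (f := p.link) (fun _ _ => Nat.zero_le _) (Finset.mem_univ k)
  · rw [← h1]
    exact (Finset.single_le_sum (f := p.fold k) (fun _ _ => Nat.zero_le _)
      (Finset.mem_univ i)).trans (Finset.single_le_sum (f := fun k => ∑ i, p.fold k i)
        (fun _ _ => Nat.zero_le _) (Finset.mem_univ k))

/-- The ring of formal power series in the two variables `a` and `b`. -/
abbrev Series : Type := MvPowerSeries (Fin 2) ℤ

/-- The variable that marks the parts in the folds. -/
noncomputable def a : Series := MvPowerSeries.X 0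

/-- The variable that marks the parts in the links. -/
noncomputable def b : Series := MvPowerSeries.X 1

/-- The bivariate generating function `∑ a ^ foldSum * b ^ linkSum` over all diamonds: the
coefficient of `a ^ m * b ^ n` is the number of diamonds with sum of folds `m` and sum of
links `n`. -/
noncomputable def sigma {M : ℕ} (d : Fin M → ℕ) : Series :=
  fun e : Fin 2 →₀ ℕ => ((diamondsOf d (e 0) (e 1)).ncard : ℤ)

/-- `omega d k` is the sum of `d_j` over `k < j ≤ M` for the one-based sequence `d_1, …, d_M`;
the element `j : Fin M` stands for the one-based index `j + 1`. -/
def omega {M : ℕ} (d : Fin M → ℕ) (k : ℕ) : ℕ :=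
  ∑ j ∈ Finset.univ.filter (fun j : Fin M => k < j.val + 1), d j

/-- The numerator; the factor `k : Fin M` is the one with one-based index `k + 1`. -/
noncomputable def numerator {M : ℕ} (d : Fin M → ℕ) : Series :=
  ∏ k : Fin M, eulerMahonian (d k) (a ^ omega d (k + 1) * b ^ (M - (k + 1) + 1)) a

/-- The denominator; the factor `k : Fin M` is the one with one-based index `k + 1`. -/
noncomputable def denominator {M : ℕ} (d : Fin M → ℕ) : Series :=
  (1 - a ^ omega d 0 * b ^ (M + 1)) *
    ∏ k : Fin M, ∏ j ∈ Finset.range (d k + 1),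
      (1 - a ^ (omega d (k + 1) + d k - j) * b ^ (M - (k + 1) + 1))

end Multifold

/-! Measure each fold from the link on its left. A diamond then splits into its first link and M
independent boxes, the k-th holding the increase c_k of the links and d_k excesses in [0, c_k]. The
first link is repeated in all ω_0 folds and M+1 links, giving a geometric series; c_k is repeated in
the ω_k later folds and in M-k+1 links. So the k-th box has series ∑ z^n [n+1]_q^{d_k} with z =
a^{ω_k} b^{M-k+1} and q = a (`sigma_eq`).

Carlitz's identity (`gf_boxWeight_mul`) evaluates it bijectively. Sort the excesses decreasingly by
τ, ties by increasing index. The successive differences of n ≥ g(τ 0) ≥ ... ≥ 0 are arbitrary,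
except that a descent of τ forces a difference of at least 1. The forced units contribute z^des
q^maj; each free unit in position j contributes z q^j, whence the factors 1/(1 - z q^j). -/

namespace Multifold

/-! ### Generating functions of weighted types -/

section GeneratingFunction

variable {σ X Y : Type*}

/-- The generating function of a weighted type: the coefficient at `e` counts the elements of
weight `e`. -/
noncomputable def gf (w : X → σ →₀ ℕ) : MvPowerSeries σ ℤ :=
  fun e => (Nat.card {x // w x = e} : ℤ)

/-- All fibres of the weight are finite. -/
def FiniteFibers (w : X → σ →₀ ℕ) : Prop := ∀ e, Finite {x // w x = e}

theorem coeff_gf (w : X → σ →₀ ℕ) (e : σ →₀ ℕ) :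
    MvPowerSeries.coeff e (gf w) = (Nat.card {x // w x = e} : ℤ) := rfl

theorem gf_congr (f : X ≃ Y) {w : X → σ →₀ ℕ} {v : Y → σ →₀ ℕ} (h : ∀ x, v (f x) = w x) :
    gf w = gf v := by
  ext e
  rw [coeff_gf, coeff_gf, Nat.card_congr (f.subtypeEquiv (q := fun y => v y = e) fun x => by rw [h])]

theorem FiniteFibers.of_injective {w : X → σ →₀ ℕ} (hw : Function.Injective w) :
    FiniteFibers w := fun e => by
  have : Subsingleton {x // w x = e} :=
    ⟨fun x y => Subtype.ext (hw (x.2.trans y.2.symm))⟩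
  infer_instance

/-- The fibre of a sum of weights, sorted by the two summands. -/
def fiberProdEquiv [DecidableEq σ] (w : X → σ →₀ ℕ) (v : Y → σ →₀ ℕ) (e : σ →₀ ℕ) :
    {x : X × Y // w x.1 + v x.2 = e} ≃
      Σ p : Finset.HasAntidiagonal.antidiagonal e, {x // w x = p.1.1} × {y // v y = p.1.2} where
  toFun x := ⟨⟨(w x.1.1, v x.1.2), Finset.HasAntidiagonal.mem_antidiagonal.2 x.2⟩, ⟨x.1.1, rfl⟩, ⟨x.1.2, rfl⟩⟩
  invFun p := ⟨(p.2.1.1, p.2.2.1), by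
    rw [p.2.1.2, p.2.2.2]; exact Finset.HasAntidiagonal.mem_antidiagonal.1 p.1.2⟩
  left_inv _ := rfl
  right_inv := by
    rintro ⟨⟨⟨p, q⟩, h⟩, ⟨x, hx⟩, ⟨y, hy⟩⟩
    dsimp only at hx hy
    subst hx hy
    rfl

theorem FiniteFibers.prod {w : X → σ →₀ ℕ} {v : Y → σ →₀ ℕ} (hw : FiniteFibers w)
    (hv : FiniteFibers v) : FiniteFibers fun x : X × Y => w x.1 + v x.2 := fun e => by
  classical
  have := hw; have := hv
  unfold FiniteFibers at *
  exact Finite.of_equiv _ (fiberProdEquiv w v e).symm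

/-- Counting each fibre by the two partial weights gives the Cauchy product. Finite fibres keep
`Nat.card` away from its default value 0. -/
theorem gf_prod {w : X → σ →₀ ℕ} {v : Y → σ →₀ ℕ} (hw : FiniteFibers w)
    (hv : FiniteFibers v) : gf (fun x : X × Y => w x.1 + v x.2) = gf w * gf v := by
  classical
  ext e
  have := hw; have := hv
  unfold FiniteFibers at *
  rw [coeff_gf, Nat.card_congr (fiberProdEquiv w v e), Nat.card_sigma, MvPowerSeries.coeff_mul,
    ← Finset.sum_coe_sort (Finset.HasAntidiagonal.antidiagonal e)]
  simp [coeff_gf, Nat.card_prod]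

theorem gf_unique [Unique X] (w : X → σ →₀ ℕ) :
    gf w = MvPowerSeries.monomial (w default) 1 := by
  classical
  ext e
  rw [coeff_gf, MvPowerSeries.coeff_monomial]
  split_ifs with h
  · have : Unique {x // w x = e} := ⟨⟨default, h.symm⟩, fun x => Subtype.ext (Unique.eq_default _)⟩
    simp
  · have : IsEmpty {x // w x = e} := ⟨fun x => h (by rw [← x.2, Unique.eq_default x.1])⟩
    simp

theorem FiniteFibers.of_finite [Finite X] (w : X → σ →₀ ℕ) : FiniteFibers w :=
  fun _ => inferInstance

theorem gf_sum {w : X → σ →₀ ℕ} {v : Y → σ →₀ ℕ} (hw : FiniteFibers w) (hv : FiniteFibers v) :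
    gf (Sum.elim w v) = gf w + gf v := by
  ext e
  have := hw; have := hv
  unfold FiniteFibers at *
  rw [map_add, coeff_gf, coeff_gf, coeff_gf, Nat.card_congr Equiv.subtypeSum]
  simp only [Sum.elim_inl, Sum.elim_inr]
  rw [Nat.card_sum, Nat.cast_add]

theorem gf_finite [Fintype X] (w : X → σ →₀ ℕ) :
    gf w = ∑ x, MvPowerSeries.monomial (w x) 1 := by
  classical
  ext e
  rw [coeff_gf, map_sum, Nat.card_eq_fintype_card, Fintype.card_subtype]
  simp [MvPowerSeries.coeff_monomial, eq_comm]

theorem FiniteFibers.pi {n : ℕ} {X : Fin n → Type*} {w : ∀ k, X k → σ →₀ ℕ}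
    (hw : ∀ k, FiniteFibers (w k)) : FiniteFibers fun x : ∀ k, X k => ∑ k, w k (x k) := by
  induction n with
  | zero => exact .of_finite _
  | succ n ih =>
    intro e
    have := (hw 0).prod (ih fun k => hw k.succ) e
    refine Finite.of_equiv _ ((Fin.consEquiv X).subtypeEquiv
      (p := fun x => w 0 x.1 + ∑ k, w k.succ (x.2 k) = e) fun x => ?_)
    simp [Fin.consEquiv, Fin.sum_univ_succ]

theorem gf_pi {n : ℕ} {X : Fin n → Type*} {w : ∀ k, X k → σ →₀ ℕ}
    (hw : ∀ k, FiniteFibers (w k)) :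
    gf (fun x : ∀ k, X k => ∑ k, w k (x k)) = ∏ k, gf (w k) := by
  induction n with
  | zero => rw [gf_unique]; simp [MvPowerSeries.monomial_zero_one]
  | succ n ih =>
    rw [Fin.prod_univ_succ, ← ih fun k => hw k.succ,
      ← gf_prod (hw 0) (.pi fun k => hw k.succ)]
    refine (gf_congr (Fin.consEquiv X) fun x => ?_).symm
    simp [Fin.consEquiv, Fin.sum_univ_succ]

theorem FiniteFibers.nsmul {v : σ →₀ ℕ} (hv : v ≠ 0) : FiniteFibers fun n : ℕ => n • v := by
  refine .of_injective fun m n h => ?_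
  obtain ⟨i, hi⟩ := Finsupp.ne_iff.1 hv
  have := DFunLike.congr_fun h i
  simp only [Finsupp.smul_apply, smul_eq_mul] at this
  exact Nat.eq_of_mul_eq_mul_right (Nat.pos_of_ne_zero hi) this

/-- The geometric series. -/
theorem gf_nsmul_mul {v : σ →₀ ℕ} (hv : v ≠ 0) :
    gf (fun n : ℕ => n • v) * (1 - MvPowerSeries.monomial v 1) = 1 := by
  -- Split ℕ into 0 and the successors, whose weights are shifted by `v`.
  have h : gf (fun n : ℕ => n • v) = 1 + MvPowerSeries.monomial v 1 * gf (fun n : ℕ => n • v) := by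
    have h1 : MvPowerSeries.monomial v 1 * gf (fun n : ℕ => n • v) =
        gf (fun n : ℕ => v + n • v) := by
      rw [← gf_unique (fun _ : Unit => v), ← gf_prod (.of_finite _) (.nsmul hv)]
      exact gf_congr (Equiv.punitProd ℕ) fun _ => rfl
    have h2 : (1 : MvPowerSeries σ ℤ) = gf (fun _ : Unit => 0) := by
      rw [gf_unique, MvPowerSeries.monomial_zero_one]
    have h3 : FiniteFibers fun n : ℕ => v + n • v := by
      refine .of_injective fun m n h => ?_
      have := add_left_cancel h
      obtain ⟨i, hi⟩ := Finsupp.ne_iff.1 hv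
      have := DFunLike.congr_fun this i
      simp only [Finsupp.smul_apply, smul_eq_mul] at this
      exact Nat.eq_of_mul_eq_mul_right (Nat.pos_of_ne_zero hi) this
    rw [h1, h2, ← gf_sum (.of_finite _) h3]
    refine (gf_congr ((Equiv.sumComm _ _).trans Equiv.natSumPUnitEquivNat) ?_).symm
    rintro (x | n)
    · exact zero_smul ℕ v
    · exact succ_nsmul' v n
  linear_combination h

end GeneratingFunction

/-! ### Carlitz's identity by stable sorting -/

section Carlitz

variable {d : ℕ}

/-- The sum of the entries of `c` from position `j` on. -/
def tail (c : Fin (d + 1) → ℕ) (j : Fin (d + 1)) : ℕ := ∑ k with j ≤ k, c k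

theorem tail_zero (c : Fin (d + 1) → ℕ) : tail c 0 = ∑ k, c k := by
  simp [tail]

theorem tail_last (c : Fin (d + 1) → ℕ) : tail c (Fin.last d) = c (Fin.last d) := by
  simp [tail, Fin.last_le_iff, Finset.filter_eq']

theorem tail_castSucc (c : Fin (d + 1) → ℕ) (i : Fin d) :
    tail c i.castSucc = c i.castSucc + tail c i.succ := by
  have : (Finset.univ.filter fun k => i.castSucc ≤ k) =
      insert i.castSucc (Finset.univ.filter fun k => i.succ ≤ k) := by
    ext k
    simp only [Finset.mem_filter, Finset.mem_univ, true_and, Finset.mem_insert, Fin.le_def,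
      Fin.ext_iff, Fin.val_castSucc, Fin.val_succ]
    omega
  rw [tail, this, Finset.sum_insert (by simp), tail]

theorem tail_antitone (c : Fin (d + 1) → ℕ) : Antitone (tail c) := fun _ _ h =>
  Finset.sum_le_sum_of_subset fun _ hk => by
    simp only [Finset.mem_filter, Finset.mem_univ, true_and] at hk ⊢
    exact h.trans hk

theorem tail_injective : Function.Injective (tail (d := d)) := by
  intro c c' h
  ext j
  induction j using Fin.lastCases with
  | last => rw [← tail_last c, h, tail_last]
  | cast i =>
    have := tail_castSucc c i
    rw [h, tail_castSucc] at this
    omega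

theorem exists_tail_eq {G : Fin (d + 1) → ℕ} (hG : Antitone G) : ∃ c, tail c = G := by
  refine ⟨Fin.lastCases (motive := fun _ => ℕ) (G (Fin.last d))
    fun i => G i.castSucc - G i.succ, ?_⟩
  ext j
  induction j using Fin.reverseInduction with
  | last => rw [tail_last, Fin.lastCases_last]
  | cast i ih =>
    rw [tail_castSucc, ih, Fin.lastCases_castSucc, Nat.sub_add_cancel (hG i.castSucc_lt_succ.le)]

/-- The entry `c j` occurs in exactly the tails from 1, ..., j. -/
theorem sum_tail_succ (c : Fin (d + 1) → ℕ) :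
    ∑ i : Fin d, tail c i.succ = ∑ j : Fin (d + 1), (j : ℕ) * c j := by
  simp only [tail, Finset.sum_filter]
  rw [Finset.sum_comm]
  refine Finset.sum_congr rfl fun j _ => ?_
  rw [← Finset.sum_filter, Finset.sum_const, smul_eq_mul]
  congr 1
  have : (Finset.univ.filter fun i : Fin d => i.succ ≤ j) =
      Finset.univ.filter fun i : Fin d => (i : ℕ) < j := by
    ext i
    simp [Fin.le_def]
  rw [this, Fin.card_filter_val_lt]
  omega

/-- The indicator of the descents of `τ`, indexed by their one-based positions. -/
def desInd (τ : Equiv.Perm (Fin d)) : Fin (d + 1) → ℕ :=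
  -- Position 0 is the gap between the bound and the largest entry; no descent ever forces it.
  Fin.cons 0 fun i => if i ∈ desSet τ then 1 else 0

theorem sum_desInd (τ : Equiv.Perm (Fin d)) : ∑ j, desInd τ j = des τ := by
  simp [desInd, des, Fin.sum_univ_succ]

theorem sum_mul_desInd (τ : Equiv.Perm (Fin d)) : ∑ j : Fin (d + 1), (j : ℕ) * desInd τ j = maj τ := by
  simp [desInd, maj, Fin.sum_univ_succ]

/-- A number together with a tuple of numbers bounded by it. -/
def Box (d : ℕ) : Type := {x : ℕ × (Fin d → ℕ) // ∀ i, x.2 i ≤ x.1}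

/-- The box point with sorting permutation `τ` and difference sequence `m`. -/
def toBox (x : Equiv.Perm (Fin d) × (Fin (d + 1) → ℕ)) : Box d :=
  ⟨(tail (x.2 + desInd x.1) 0, fun i => tail (x.2 + desInd x.1) (x.1.symm i).succ),
    fun _ => tail_antitone _ (Fin.zero_le _)⟩

theorem lt_of_notMem_desSet {τ : Equiv.Perm (Fin d)} {i : Fin d} (hi : i ∉ desSet τ)
    (h : (i : ℕ) + 1 < d) : τ i < τ ⟨i + 1, h⟩ := by
  simp only [desSet, Finset.mem_filter, Finset.mem_univ, true_and, not_exists, not_lt] at hi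
  refine lt_of_le_of_ne (hi h) fun he => ?_
  have := congrArg Fin.val (τ.injective he)
  simp at this

/-- This recovers τ from the box point. The order dual makes the sort decreasing. A tie between
neighbours means a zero difference, hence no descent, so τ increases along ties. -/
theorem toBox_sort (x : Equiv.Perm (Fin d) × (Fin (d + 1) → ℕ)) :
    x.1 = Tuple.sort (OrderDual.toDual ∘ (toBox x).1.2) := by
  obtain ⟨τ, m⟩ := x
  rw [Tuple.eq_sort_iff]
  have hτ (i : Fin d) : (toBox (τ, m)).1.2 (τ i) = tail (m + desInd τ) i.succ := by
    simp [toBox]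
  simp only [Function.comp_apply, hτ, EmbeddingLike.apply_eq_iff_eq]
  refine ⟨fun i j h => ?_, ?_⟩
  · simp only [Function.comp_apply, hτ]
    exact OrderDual.toDual_le_toDual.2 (tail_antitone _ (Fin.succ_le_succ_iff.2 h))
  · rintro ⟨i, hi⟩ ⟨j, hj⟩ h
    rw [Fin.mk_lt_mk] at h
    -- Equal values at `i` and `j` force equality in between, so neighbours suffice.
    induction j, h using Nat.le_induction with
    | base =>
      intro he
      refine lt_of_notMem_desSet (i := ⟨i, hi⟩) (fun hmem => ?_) hj
      have := tail_castSucc (m + desInd τ) ⟨i + 1, hj⟩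
      have h2 : desInd τ (Fin.castSucc ⟨i + 1, hj⟩) = 1 := by
        have : Fin.castSucc ⟨i + 1, hj⟩ = Fin.succ ⟨i, hi⟩ := rfl
        rw [this, desInd, Fin.cons_succ, if_pos hmem]
      have h3 : Fin.castSucc ⟨i + 1, hj⟩ = Fin.succ ⟨i, hi⟩ := rfl
      rw [Pi.add_apply, h2, h3] at this
      have he' : tail (m + desInd τ) (Fin.succ ⟨i, hi⟩) =
          tail (m + desInd τ) (Fin.succ ⟨i + 1, hj⟩) := he
      omega
    | succ j h ih =>
      intro he
      have hj' : j < d := by omega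
      have h1 := tail_antitone (m + desInd τ)
        (show Fin.succ ⟨i, hi⟩ ≤ Fin.succ ⟨j, hj'⟩ by simp [Fin.le_def]; omega)
      have h2 := tail_antitone (m + desInd τ)
        (show Fin.succ ⟨j, hj'⟩ ≤ Fin.succ ⟨j + 1, hj⟩ by simp [Fin.le_def])
      refine (ih hj' (by omega)).trans (lt_of_notMem_desSet (i := ⟨j, hj'⟩) (fun hmem => ?_) hj)
      have := tail_castSucc (m + desInd τ) ⟨j + 1, hj⟩
      have h3 : Fin.castSucc ⟨j + 1, hj⟩ = Fin.succ ⟨j, hj'⟩ := rfl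
      have h4 : desInd τ (Fin.succ ⟨j, hj'⟩) = 1 := by
        rw [desInd, Fin.cons_succ, if_pos hmem]
      rw [h3, Pi.add_apply, h4] at this
      omega

theorem toBox_injective : Function.Injective (toBox (d := d)) := by
  intro x y h
  have h1 : x.1 = y.1 := by rw [toBox_sort x, toBox_sort y, h]
  obtain ⟨τ, m⟩ := x
  obtain ⟨τ', m'⟩ := y
  obtain rfl : τ = τ' := h1
  have h2 : tail (m + desInd τ) = tail (m' + desInd τ) := by
    ext j
    induction j using Fin.cases with
    | zero => exact congrArg (fun x : Box d => x.1.1) h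
    | succ i => simpa [toBox] using congrArg (fun x : Box d => x.1.2 (τ i)) h
  rw [add_right_cancel (tail_injective h2)]

theorem toBox_surjective : Function.Surjective (toBox (d := d)) := by
  rintro ⟨⟨n, g⟩, hg⟩
  obtain ⟨τ, hτ⟩ : ∃ τ, τ = Tuple.sort (OrderDual.toDual ∘ g) := ⟨_, rfl⟩
  obtain ⟨hmono, htie⟩ := Tuple.eq_sort_iff.1 hτ
  have hG : Antitone (Fin.cons n (g ∘ τ) : Fin (d + 1) → ℕ) := by
    intro i j h
    induction j using Fin.cases with
    | zero => rw [Fin.le_zero_iff.1 h]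
    | succ j =>
      induction i using Fin.cases with
      | zero => exact hg _
      | succ i => exact OrderDual.toDual_le_toDual.1 (hmono (Fin.succ_le_succ_iff.1 h))
  obtain ⟨c, hc⟩ := exists_tail_eq hG
  -- At a descent the sorted values drop strictly, since stable sorting puts ties in increasing
  -- order.
  have hle : desInd τ ≤ c := by
    intro j
    induction j using Fin.cases with
    | zero => simp [desInd]
    | succ i =>
      rw [desInd, Fin.cons_succ]
      split_ifs with hi
      · obtain ⟨h, hlt⟩ := (Finset.mem_filter.1 hi).2
        have h1 := tail_castSucc c ⟨i + 1, h⟩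
        have h3 : Fin.castSucc ⟨i + 1, h⟩ = Fin.succ i := rfl
        rw [h3, hc, Fin.cons_succ, Fin.cons_succ] at h1
        by_contra! h0
        have h4 : c i.succ = 0 := Nat.lt_one_iff.1 h0
        rw [h4, zero_add] at h1
        exact lt_asymm hlt (htie i ⟨i + 1, h⟩ (by simp [Fin.lt_def])
          (congrArg OrderDual.toDual h1))
      · exact Nat.zero_le _
  refine ⟨(τ, c - desInd τ), ?_⟩
  refine Subtype.ext (Prod.ext ?_ (funext fun i => ?_)) <;>
    simp [toBox, tsub_add_cancel_of_le hle, hc]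

theorem toBox_bijective : Function.Bijective (toBox (d := d)) :=
  ⟨toBox_injective, toBox_surjective⟩

/-- The weight of a box point: `z` for the bound, `q` for each unit in the tuple. -/
noncomputable def boxWeight {σ : Type*} (z q : σ →₀ ℕ) (x : Box d) : σ →₀ ℕ :=
  x.1.1 • z + (∑ i, x.1.2 i) • q

theorem boxWeight_toBox {σ : Type*} (z q : σ →₀ ℕ)
    (x : Equiv.Perm (Fin d) × (Fin (d + 1) → ℕ)) :
    boxWeight z q (toBox x) =
      (des x.1 • z + maj x.1 • q) + ∑ j : Fin (d + 1), x.2 j • (z + (j : ℕ) • q) := by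
  obtain ⟨τ, m⟩ := x
  have h : ∑ i, (toBox (τ, m)).1.2 i = ∑ j : Fin (d + 1), (j : ℕ) * (m + desInd τ) j := by
    rw [← sum_tail_succ, ← Equiv.sum_comp τ]
    simp [toBox]
  rw [boxWeight, h]
  simp only [toBox, tail_zero, Pi.add_apply, mul_add, Finset.sum_add_distrib, sum_desInd,
    sum_mul_desInd, add_smul, smul_add, Finset.sum_smul, smul_smul]
  simp only [mul_comm]
  abel

theorem add_nsmul_ne_zero {σ : Type*} {z : σ →₀ ℕ} (hz : z ≠ 0) (q : σ →₀ ℕ) (j : ℕ) :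
    z + j • q ≠ 0 := fun h => hz (add_eq_zero.1 h).1

/-- `q` may vanish: `z` controls the bound, and the bound controls the tuple. -/
theorem finiteFibers_boxWeight {σ : Type*} {z : σ →₀ ℕ} (hz : z ≠ 0) (q : σ →₀ ℕ) :
    FiniteFibers (boxWeight (d := d) z q) := fun e => by
  have := FiniteFibers.prod (.of_finite fun τ : Equiv.Perm (Fin d) => des τ • z + maj τ • q)
    (.pi fun j : Fin (d + 1) => .nsmul (add_nsmul_ne_zero hz q j)) e
  refine Finite.of_equiv _ ((Equiv.ofBijective toBox
    toBox_bijective).subtypeEquiv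
      (p := fun x => (des x.1 • z + maj x.1 • q) +
        ∑ j : Fin (d + 1), x.2 j • (z + (j : ℕ) • q) = e) fun x => ?_)
  rw [Equiv.ofBijective_apply, boxWeight_toBox]

/-- Carlitz's identity: `∑ₙ [n + 1]_q ^ d z ^ n = E_d(z, q) / ∏ⱼ (1 - z q ^ j)`. -/
theorem gf_boxWeight_mul {σ : Type*} {z : σ →₀ ℕ} (hz : z ≠ 0) (q : σ →₀ ℕ) :
    gf (boxWeight (d := d) z q) *
        ∏ j ∈ Finset.range (d + 1), (1 - MvPowerSeries.monomial (z + j • q) 1) =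
      eulerMahonian d (MvPowerSeries.monomial z 1) (MvPowerSeries.monomial q 1) := by
  rw [← gf_congr (Equiv.ofBijective toBox toBox_bijective)
      (fun x => boxWeight_toBox z q x),
    gf_prod (.of_finite fun τ : Equiv.Perm (Fin d) => des τ • z + maj τ • q)
      (.pi fun j : Fin (d + 1) => .nsmul (add_nsmul_ne_zero hz q j)),
    gf_pi fun j : Fin (d + 1) => .nsmul (add_nsmul_ne_zero hz q j), Finset.prod_range, mul_assoc,
    ← Finset.prod_mul_distrib,
    Finset.prod_congr rfl fun (j : Fin (d + 1)) _ => gf_nsmul_mul (add_nsmul_ne_zero hz q j),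
    Finset.prod_const_one, mul_one, gf_finite, eulerMahonian]
  refine Finset.sum_congr rfl fun τ _ => ?_
  simp [MvPowerSeries.monomial_pow, MvPowerSeries.monomial_mul_monomial]

end Carlitz

/-! ### Cutting a diamond into boxes -/

section Decomposition

variable {M : ℕ} {d : Fin M → ℕ}

/-- The links with first value `n` and successive differences `c`. -/
def linkOf (n : ℕ) (c : Fin M → ℕ) (k : Fin (M + 1)) : ℕ := n + ∑ j with j.castSucc < k, c j

theorem linkOf_zero (n : ℕ) (c : Fin M → ℕ) : linkOf n c 0 = n := by
  simp [linkOf]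

theorem linkOf_succ (n : ℕ) (c : Fin M → ℕ) (k : Fin M) :
    linkOf n c k.succ = linkOf n c k.castSucc + c k := by
  have : (Finset.univ.filter fun j : Fin M => j.castSucc < k.succ) =
      insert k (Finset.univ.filter fun j : Fin M => j.castSucc < k.castSucc) := by
    ext j
    simp only [Finset.mem_filter, Finset.mem_univ, true_and, Finset.mem_insert, Fin.lt_def,
      Fin.ext_iff, Fin.val_castSucc, Fin.val_succ]
    omega
  rw [linkOf, this, Finset.sum_insert (by simp), linkOf]
  ring

/-- Consecutive links are compared only through a fold, so each `d k` must be positive. -/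
theorem Diamond.link_castSucc_le_succ (hd : ∀ k, 0 < d k) (p : Diamond d) (k : Fin M) :
    p.link k.castSucc ≤ p.link k.succ :=
  (p.link_le_fold k ⟨0, hd k⟩).trans (p.fold_le_link k ⟨0, hd k⟩)

/-- A diamond is determined by its first link and, for each fold, the increase of the links and
the excesses of the fold parts over the left link. -/
def diamondEquiv (hd : ∀ k, 0 < d k) : ℕ × (∀ k, Box (d k)) ≃ Diamond d where
  toFun x :=
    { link := linkOf x.1 fun k => (x.2 k).1.1
      fold := fun k i => linkOf x.1 (fun k => (x.2 k).1.1) k.castSucc + (x.2 k).1.2 i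
      link_le_fold := fun _ _ => Nat.le_add_right _ _
      fold_le_link := fun k i => by
        rw [linkOf_succ]
        exact Nat.add_le_add_left ((x.2 k).2 i) _ }
  invFun p := (p.link 0, fun k => ⟨(p.link k.succ - p.link k.castSucc,
    fun i => p.fold k i - p.link k.castSucc), fun i =>
      Nat.sub_le_sub_right (p.fold_le_link k i) _⟩)
  left_inv x := by
    refine Prod.ext (linkOf_zero _ _) (funext fun k => Subtype.ext (Prod.ext ?_ ?_))
    · simp [linkOf_succ]
    · simp
  right_inv p := by
    have h (k : Fin (M + 1)) :
        linkOf (p.link 0) (fun k => p.link k.succ - p.link k.castSucc) k = p.link k := by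
      induction k using Fin.induction with
      | zero => exact linkOf_zero _ _
      | succ k ih => rw [linkOf_succ, ih, Nat.add_sub_cancel' (p.link_castSucc_le_succ hd k)]
    refine Diamond.ext (funext h) (funext fun k => funext fun i => ?_)
    simp only [h]
    exact Nat.add_sub_cancel' (p.link_le_fold k i)

/-- The increase at `k` enters the left link of exactly the diamonds after `k`; exchanging sums
collects these folds into `omega d (k + 1)`. -/
theorem foldSum_diamondEquiv (hd : ∀ k, 0 < d k) (x : ℕ × (∀ k, Box (d k))) :
    (diamondEquiv hd x).foldSum =
      omega d 0 * x.1 + ∑ k : Fin M, (omega d (k + 1) * (x.2 k).1.1 + ∑ i, (x.2 k).1.2 i) := by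
  simp only [Diamond.foldSum, diamondEquiv, Equiv.coe_fn_mk, linkOf, Finset.sum_add_distrib,
    Finset.sum_const, Finset.card_univ, Fintype.card_fin, smul_eq_mul, ← add_assoc, omega,
    Finset.sum_mul, Finset.mul_sum, Finset.sum_filter, Nat.zero_lt_succ, if_true, ite_mul,
    mul_ite, zero_mul, mul_zero]
  congr 2
  rw [Finset.sum_comm]
  simp only [Fin.castSucc_lt_castSucc_iff, add_lt_add_iff_right, Fin.val_fin_lt]

theorem linkSum_diamondEquiv (hd : ∀ k, 0 < d k) (x : ℕ × (∀ k, Box (d k))) :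
    (diamondEquiv hd x).linkSum =
      (M + 1) * x.1 + ∑ k : Fin M, (M - (k + 1) + 1) * (x.2 k).1.1 := by
  simp only [Diamond.linkSum, diamondEquiv, Equiv.coe_fn_mk, linkOf, Finset.sum_add_distrib,
    Finset.sum_const, Finset.card_univ, Fintype.card_fin, smul_eq_mul, Finset.sum_filter]
  congr 1
  rw [Finset.sum_comm]
  refine Finset.sum_congr rfl fun k _ => ?_
  rw [← Finset.sum_filter, Finset.sum_const, smul_eq_mul, Finset.filter_lt_eq_Ioi, Fin.card_Ioi,
    Fin.val_castSucc]
  congr 1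
  omega

/-- The exponent of `a ^ m * b ^ n`. -/
noncomputable def expo (m n : ℕ) : Fin 2 →₀ ℕ := Finsupp.single 0 m + Finsupp.single 1 n

theorem a_pow_mul_b_pow (m n : ℕ) : a ^ m * b ^ n = MvPowerSeries.monomial (expo m n) 1 := by
  simp [a, b, expo, MvPowerSeries.X_pow_eq, MvPowerSeries.monomial_mul_monomial]

theorem expo_eq_iff (m n : ℕ) (e : Fin 2 →₀ ℕ) : expo m n = e ↔ m = e 0 ∧ n = e 1 := by
  simp [expo, Finsupp.ext_iff]

theorem expo_succ_ne_zero (m n : ℕ) : expo m (n + 1) ≠ 0 := by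
  simp [expo_eq_iff, Ne]

theorem sigma_eq_gf (d : Fin M → ℕ) :
    sigma d = gf fun p : Diamond d => expo p.foldSum p.linkSum := by
  ext e
  rw [coeff_gf]
  simp only [expo_eq_iff]
  rfl

theorem sigma_eq (hd : ∀ k, 0 < d k) :
    sigma d = gf (fun n : ℕ => n • expo (omega d 0) (M + 1)) *
      ∏ k : Fin M, gf (boxWeight (d := d k) (expo (omega d (k + 1)) (M - (k + 1) + 1))
        (expo 1 0)) := by
  rw [sigma_eq_gf, ← gf_pi fun k => finiteFibers_boxWeight (expo_succ_ne_zero _ _) _,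
    ← gf_prod (.nsmul (expo_succ_ne_zero _ _))
      (.pi fun k => finiteFibers_boxWeight (expo_succ_ne_zero _ _) _)]
  refine (gf_congr (diamondEquiv hd) fun x => ?_).symm
  rw [expo_eq_iff, foldSum_diamondEquiv, linkSum_diamondEquiv]
  constructor
  · simp [boxWeight, expo, mul_comm]
  · simp only [boxWeight, expo, Finsupp.coe_add, Finsupp.finsetSum_apply, Pi.add_apply,
      Finsupp.smul_apply, smul_eq_mul]
    simp [mul_comm]

theorem denominator_eq (d : Fin M → ℕ) :
    denominator d = (1 - MvPowerSeries.monomial (expo (omega d 0) (M + 1)) 1) *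
      ∏ k : Fin M, ∏ j ∈ Finset.range (d k + 1),
        (1 - MvPowerSeries.monomial
          (expo (omega d (k + 1)) (M - (k + 1) + 1) + j • expo 1 0) 1) := by
  rw [denominator, a_pow_mul_b_pow]
  congr 1
  refine Finset.prod_congr rfl fun k _ => ?_
  -- The exponents d_k - j run through the same range as j, in reverse.
  rw [← Finset.prod_range_reflect]
  refine Finset.prod_congr rfl fun j hj => ?_
  have hj := Finset.mem_range.1 hj
  rw [a_pow_mul_b_pow]
  congr 3
  rw [expo_eq_iff]
  simp [expo]
  omega

/-- Each factor is inverted by a geometric series, as its monomial has a positive power of `b`. -/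
theorem isUnit_denominator (d : Fin M → ℕ) : IsUnit (denominator d) := by
  have h {v : Fin 2 →₀ ℕ} (hv : v ≠ 0) :
      IsUnit (1 - MvPowerSeries.monomial v 1 : Series) :=
    IsUnit.of_mul_eq_one_right _ (gf_nsmul_mul hv)
  rw [denominator_eq]
  refine (h (expo_succ_ne_zero _ _)).mul (IsUnit.prod_univ_iff.2 fun k =>
    IsUnit.prod_iff.2 fun j _ => h (add_nsmul_ne_zero (expo_succ_ne_zero _ _) _ _))

theorem sigma_mul_denominator (hd : ∀ k, 0 < d k) : sigma d * denominator d = numerator d := by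
  rw [sigma_eq hd, denominator_eq, mul_mul_mul_comm, gf_nsmul_mul (expo_succ_ne_zero _ _), one_mul,
    ← Finset.prod_mul_distrib, numerator]
  refine Finset.prod_congr rfl fun k _ => ?_
  rw [gf_boxWeight_mul (expo_succ_ne_zero _ _), a_pow_mul_b_pow, ← a_pow_mul_b_pow 1 0]
  simp

end Decomposition

end Multifold

/-- The denominator is invertible in the ring of formal power series and
`sigma d = numerator d / denominator d`. -/
theorem mainTheorem3 (M : ℕ) (d : Fin M → ℕ) (hd : ∀ k, 0 < d k) :
    ∃ hD : IsUnit (Multifold.denominator d),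
      Multifold.sigma d = Multifold.numerator d *
        ((hD.unit⁻¹ : Multifold.Seriesˣ) : Multifold.Series) := by
  refine ⟨Multifold.isUnit_denominator d, ?_⟩
  rw [Units.eq_mul_inv_iff_mul_eq, IsUnit.unit_spec, Multifold.sigma_mul_denominator hd]
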